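/- Let $\rho>1/2$, $\epsilon>0$, $t>0$ and $\theta$ be real, let $\mu=\mu_R+i\mu_I\in\mathbb C$ ($\mu_R,\mu_I$ real), let $z=te^{i\theta}$, and let $$E_{\rho,\mu}(z)=\sum_{k=0}^{\infty}\frac{z^k}{\Gamma(\mu+k/\rho)}$$ be the Mittag-Leffler function (the series converges; $1/\Gamma$ is taken to be $0$ at the poles of $\Gamma$). For $r>0$ and $\varphi\in\mathbb R$ put $$f(r,\varphi,t,\theta)=\exp\{(tr)^\rho\cos(\rho(\theta+\varphi))+\rho\mu_I(\theta+\varphi)\},$$ $$\xi(r,\varphi,t,\theta)=(tr)^\rho\sin(\rho(\theta+\varphi))+\rho(1-\mu_R)(\theta+\varphi)-\rho\mu_I\ln(tr),$$ $$P^{Re}_{\rho,\mu}(r,\varphi,t,\theta)=\frac{\rho}{2\pi}\,\frac{(tr)^{\rho(1-\mu_R)}\,r\,f(r,\varphi,t,\theta)}{r^2-2r\cos\varphi+1}\,\bigl(r\cos(\xi(r,\varphi,t,\theta))-\cos(\xi(r,\varphi,t,\theta)+\varphi)\bigr),$$ $$P^{Im}_{\rho,\mu}(r,\varphi,t,\theta)=\frac{\rho}{2\pi}\,\frac{(tr)^{\rho(1-\mu_R)}\,r\,f(r,\varphi,t,\theta)}{r^2-2r\cos\varphi+1}\,\bigl(r\sin(\xi(r,\varphi,t,\theta))-\sin(\xi(r,\varphi,t,\theta)+\varphi)\bigr).$$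 1) Let $\delta_\rho$ be real with $\pi/(2\rho)<\delta_\rho\leqslant\min(\pi,\pi/\rho)$ and suppose that $\frac{\pi}{2\rho}-\delta_\rho+\pi<\theta<-\frac{\pi}{2\rho}+\delta_\rho+\pi$. Then $$E_{\rho,\mu}(z)=\int_{1+\epsilon}^{\infty}K^{Re}_{\rho,\mu}(r,\delta_\rho,t,\theta)\,dr+\int_{-\delta_\rho-\pi}^{\delta_\rho-\pi}P^{Re}_{\rho,\mu}(1+\epsilon,\varphi,t,\theta)\,d\varphi+i\left\{\int_{1+\epsilon}^{\infty}K^{Im}_{\rho,\mu}(r,\delta_\rho,t,\theta)\,dr+\int_{-\delta_\rho-\pi}^{\delta_\rho-\pi}P^{Im}_{\rho,\mu}(1+\epsilon,\varphi,t,\theta)\,d\varphi\right\},$$ where all the integrals converge absolutely and, with $\xi_\pm=\xi(r,\pm\delta_\rho-\pi,t,\theta)$ and $f_\pm=f(r,\pm\delta_\rho-\pi,t,\theta)$, $$K^{Re}_{\rho,\mu}(r,\delta_\rho,t,\theta)=\frac{\rho}{2\pi}\,\frac{(tr)^{\rho(1-\mu_R)}}{r^2+2r\cos\delta_\rho+1}\Bigl[f_+\bigl(r\sin\xi_++\sin(\xi_++\delta_\rho)\bigr)-f_-\bigl(r\sin\xi_-+\sin(\xi_--\delta_\rho)\bigr)\Bigr],$$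 $$K^{Im}_{\rho,\mu}(r,\delta_\rho,t,\theta)=\frac{\rho}{2\pi}\,\frac{(tr)^{\rho(1-\mu_R)}}{r^2+2r\cos\delta_\rho+1}\Bigl[f_-\bigl(r\cos\xi_-+\cos(\xi_--\delta_\rho)\bigr)-f_+\bigl(r\cos\xi_++\cos(\xi_++\delta_\rho)\bigr)\Bigr].$$ 2) Let $\rho\geqslant1$ and $\delta_\rho=\pi/\rho$, and suppose again that $\frac{\pi}{2\rho}-\delta_\rho+\pi<\theta<-\frac{\pi}{2\rho}+\delta_\rho+\pi$. Then $$E_{\rho,\mu}(z)=\int_{1+\epsilon}^{\infty}K^{Re}_{\rho,\mu}(r,t,\theta)\,dr+\int_{-\pi/\rho-\pi}^{\pi/\rho-\pi}P^{Re}_{\rho,\mu}(1+\epsilon,\varphi,t,\theta)\,d\varphi+i\left\{\int_{1+\epsilon}^{\infty}K^{Im}_{\rho,\mu}(r,t,\theta)\,dr+\int_{-\pi/\rho-\pi}^{\pi/\rho-\pi}P^{Im}_{\rho,\mu}(1+\epsilon,\varphi,t,\theta)\,d\varphi\right\},$$ where all the integrals converge absolutely and, with $$\varrho=\varrho(r,t,\theta)=-(tr)^\rho\cos(\rho(\theta-\pi))+\rho\mu_I(\theta-\pi),$$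 $$\xi'=\xi'(r,t,\theta)=-(tr)^\rho\sin(\rho(\theta-\pi))+\rho(1-\mu_R)(\theta-\pi)-\rho\mu_I\ln(tr)$$ and $\xi'_\pm=\xi'\pm(1-\mu_R)\pi$, $$K^{Re}_{\rho,\mu}(r,t,\theta)=\frac{\rho}{2\pi}\,\frac{(tr)^{\rho(1-\mu_R)}e^{\varrho}}{r^2+2r\cos(\pi/\rho)+1}\Bigl[e^{\mu_I\pi}\bigl(r\sin\xi'_++\sin(\xi'_++\pi/\rho)\bigr)-e^{-\mu_I\pi}\bigl(r\sin\xi'_-+\sin(\xi'_--\pi/\rho)\bigr)\Bigr],$$ $$K^{Im}_{\rho,\mu}(r,t,\theta)=\frac{\rho}{2\pi}\,\frac{(tr)^{\rho(1-\mu_R)}e^{\varrho}}{r^2+2r\cos(\pi/\rho)+1}\Bigl[e^{-\mu_I\pi}\bigl(r\cos\xi'_-+\cos(\xi'_--\pi/\rho)\bigr)-e^{\mu_I\pi}\bigl(r\cos\xi'_++\cos(\xi'_++\pi/\rho)\bigr)\Bigr].$$ -/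

import Mathlib

open MeasureTheory Set

noncomputable section

/-- The `k`-th term `z ^ k / Γ(μ + k / ρ)` of the Mittag-Leffler series. At the poles of `Γ`,
where `1 / Γ` vanishes, Mathlib's convention `Γ = 0`, `x / 0 = 0` gives the right value `0`. -/
def mittagLefflerTerm (ρ : ℝ) (μ z : ℂ) (k : ℕ) : ℂ :=
  z ^ k / Complex.Gamma (μ + (k : ℂ) / (ρ : ℂ))

/-- The two-parameter Mittag-Leffler function `E_{ρ,μ}(z) = ∑ z ^ k / Γ(μ + k / ρ)`. -/
def mittagLeffler (ρ : ℝ) (μ z : ℂ) : ℂ :=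
  ∑' k : ℕ, mittagLefflerTerm ρ μ z k

/-- `f(r, φ, t, θ)`. -/
def mlF (ρ : ℝ) (μ : ℂ) (r φ t θ : ℝ) : ℝ :=
  Real.exp ((t * r) ^ ρ * Real.cos (ρ * (θ + φ)) + ρ * μ.im * (θ + φ))

/-- `ξ(r, φ, t, θ)`. -/
def mlXi (ρ : ℝ) (μ : ℂ) (r φ t θ : ℝ) : ℝ :=
  (t * r) ^ ρ * Real.sin (ρ * (θ + φ)) + ρ * (1 - μ.re) * (θ + φ)
    - ρ * μ.im * Real.log (t * r)

/-- `P^{Re}(r, φ, t, θ)`. -/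
def mlPRe (ρ : ℝ) (μ : ℂ) (r φ t θ : ℝ) : ℝ :=
  ρ / (2 * Real.pi) *
    ((t * r) ^ (ρ * (1 - μ.re)) * r * mlF ρ μ r φ t θ / (r ^ 2 - 2 * r * Real.cos φ + 1)) *
    (r * Real.cos (mlXi ρ μ r φ t θ) - Real.cos (mlXi ρ μ r φ t θ + φ))

/-- `P^{Im}(r, φ, t, θ)`. -/
def mlPIm (ρ : ℝ) (μ : ℂ) (r φ t θ : ℝ) : ℝ :=
  ρ / (2 * Real.pi) *
    ((t * r) ^ (ρ * (1 - μ.re)) * r * mlF ρ μ r φ t θ / (r ^ 2 - 2 * r * Real.cos φ + 1)) *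
    (r * Real.sin (mlXi ρ μ r φ t θ) - Real.sin (mlXi ρ μ r φ t θ + φ))

/-- The symmetric kernel `K^{Re}(r, δ, t, θ)`. -/
def mlKRe (ρ : ℝ) (μ : ℂ) (r δ t θ : ℝ) : ℝ :=
  ρ / (2 * Real.pi) *
    ((t * r) ^ (ρ * (1 - μ.re)) / (r ^ 2 + 2 * r * Real.cos δ + 1)) *
    (mlF ρ μ r (δ - Real.pi) t θ *
        (r * Real.sin (mlXi ρ μ r (δ - Real.pi) t θ)
          + Real.sin (mlXi ρ μ r (δ - Real.pi) t θ + δ))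
      - mlF ρ μ r (-δ - Real.pi) t θ *
        (r * Real.sin (mlXi ρ μ r (-δ - Real.pi) t θ)
          + Real.sin (mlXi ρ μ r (-δ - Real.pi) t θ - δ)))

/-- The symmetric kernel `K^{Im}(r, δ, t, θ)`. -/
def mlKIm (ρ : ℝ) (μ : ℂ) (r δ t θ : ℝ) : ℝ :=
  ρ / (2 * Real.pi) *
    ((t * r) ^ (ρ * (1 - μ.re)) / (r ^ 2 + 2 * r * Real.cos δ + 1)) *
    (mlF ρ μ r (-δ - Real.pi) t θ *
        (r * Real.cos (mlXi ρ μ r (-δ - Real.pi) t θ)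
          + Real.cos (mlXi ρ μ r (-δ - Real.pi) t θ - δ))
      - mlF ρ μ r (δ - Real.pi) t θ *
        (r * Real.cos (mlXi ρ μ r (δ - Real.pi) t θ)
          + Real.cos (mlXi ρ μ r (δ - Real.pi) t θ + δ)))

/-- `ϱ(r, t, θ)`. -/
def mlVarrho (ρ : ℝ) (μ : ℂ) (r t θ : ℝ) : ℝ :=
  -(t * r) ^ ρ * Real.cos (ρ * (θ - Real.pi)) + ρ * μ.im * (θ - Real.pi)

/-- `ξ'(r, t, θ)`. -/
def mlXi' (ρ : ℝ) (μ : ℂ) (r t θ : ℝ) : ℝ :=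
  -(t * r) ^ ρ * Real.sin (ρ * (θ - Real.pi)) + ρ * (1 - μ.re) * (θ - Real.pi)
    - ρ * μ.im * Real.log (t * r)

/-- The kernel `K^{Re}(r, t, θ)` of the case `δ = π / ρ`. -/
def mlKRePi (ρ : ℝ) (μ : ℂ) (r t θ : ℝ) : ℝ :=
  ρ / (2 * Real.pi) *
    ((t * r) ^ (ρ * (1 - μ.re)) * Real.exp (mlVarrho ρ μ r t θ)
      / (r ^ 2 + 2 * r * Real.cos (Real.pi / ρ) + 1)) *
    (Real.exp (μ.im * Real.pi) *
        (r * Real.sin (mlXi' ρ μ r t θ + (1 - μ.re) * Real.pi)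
          + Real.sin (mlXi' ρ μ r t θ + (1 - μ.re) * Real.pi + Real.pi / ρ))
      - Real.exp (-μ.im * Real.pi) *
        (r * Real.sin (mlXi' ρ μ r t θ - (1 - μ.re) * Real.pi)
          + Real.sin (mlXi' ρ μ r t θ - (1 - μ.re) * Real.pi - Real.pi / ρ)))

/-- The kernel `K^{Im}(r, t, θ)` of the case `δ = π / ρ`. -/
def mlKImPi (ρ : ℝ) (μ : ℂ) (r t θ : ℝ) : ℝ :=
  ρ / (2 * Real.pi) *
    ((t * r) ^ (ρ * (1 - μ.re)) * Real.exp (mlVarrho ρ μ r t θ)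
      / (r ^ 2 + 2 * r * Real.cos (Real.pi / ρ) + 1)) *
    (Real.exp (-μ.im * Real.pi) *
        (r * Real.cos (mlXi' ρ μ r t θ - (1 - μ.re) * Real.pi)
          + Real.cos (mlXi' ρ μ r t θ - (1 - μ.re) * Real.pi - Real.pi / ρ))
      - Real.exp (μ.im * Real.pi) *
        (r * Real.cos (mlXi' ρ μ r t θ + (1 - μ.re) * Real.pi)
          + Real.cos (mlXi' ρ μ r t θ + (1 - μ.re) * Real.pi + Real.pi / ρ)))

end

/-!
By Hankel's formula, `1 / Γ(ν)` is `(2πi)⁻¹` times the integral of `e ^ ζ ζ ^ (-ν)` along a contour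
around the negative half-axis. In the coordinate `s = log ζ` the branch cut disappears: the
integrand `exp (e ^ s + (1 - ν) s)` is entire, and the contour consists of three sides of a
half-infinite rectangle, which may be moved freely as long as its horizontal sides stay where
`cos (Im s) < 0`. For `Re ν < 1`, moving the vertical side to `-∞` leaves a multiple of `Γ(1 - ν)`,
and the reflection formula applies; integration by parts then reaches every `ν` from there.

Taking `ν = μ + k / ρ` and summing the geometric series in `z e ^ (-s / ρ)` under the integral sign,
which is allowed where `|z| e ^ (-Re s / ρ) < 1`, represents `E_{ρ,μ}(z)`. In polar coordinates
`s = ρ (log (t r) + i (θ + φ))` the vertical side becomes the integral of `P` and the two horizontal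
sides together become the integral of `K`.
-/

noncomputable section

open Complex Filter Topology
open scoped Real

section HankelContour

variable {E : Type*} [NormedAddCommGroup E] {f g : ℂ → E} {c c' a a' b b' : ℝ}

/-- Absolute integrability along the contour of `hankelIntegral` below. -/
structure HankelIntegrable (g : ℂ → E) (c a b : ℝ) : Prop where
  vertical : IntervalIntegrable (fun y : ℝ ↦ g (c + y * I)) volume a b
  lower : IntegrableOn (fun x : ℝ ↦ g (x + a * I)) (Ioi c)
  upper : IntegrableOn (fun x : ℝ ↦ g (x + b * I)) (Ioi c)

theorem HankelIntegrable.sub (hf : HankelIntegrable f c a b) (hg : HankelIntegrable g c a b) :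
    HankelIntegrable (f - g) c a b :=
  ⟨hf.vertical.sub hg.vertical, hf.lower.sub hg.lower, hf.upper.sub hg.upper⟩

variable [NormedSpace ℂ E]

/-- The integral of `g` along the Hankel contour in the coordinate `s = log ζ`: the contour comes
in from `+∞` along the line `Im s = a`, turns at `Re s = c` and returns to `+∞` along the line
`Im s = b`. -/
def hankelIntegral (g : ℂ → E) (c a b : ℝ) : E :=
  I • (∫ y in a..b, g (c + y * I)) + (∫ x in Ioi c, g (x + b * I)) - ∫ x in Ioi c, g (x + a * I)

theorem HankelIntegrable.const_smul (hg : HankelIntegrable g c a b) (k : ℂ) :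
    HankelIntegrable (k • g) c a b :=
  ⟨hg.vertical.smul k, hg.lower.smul k, hg.upper.smul k⟩

theorem hankelIntegral_sub (hf : HankelIntegrable f c a b) (hg : HankelIntegrable g c a b) :
    hankelIntegral (f - g) c a b = hankelIntegral f c a b - hankelIntegral g c a b := by
  simp only [hankelIntegral, Pi.sub_apply, integral_sub hf.lower hg.lower,
    integral_sub hf.upper hg.upper, intervalIntegral.integral_sub hf.vertical hg.vertical]
  module

theorem hankelIntegral_const_smul (k : ℂ) (g : ℂ → E) :
    hankelIntegral (k • g) c a b = k • hankelIntegral g c a b := by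
  simp only [hankelIntegral, Pi.smul_apply, integral_smul, intervalIntegral.integral_smul]
  module

theorem hasDerivAt_comp_add_mul_I_left {G : ℂ → E} (x y : ℝ)
    (h : HasDerivAt G (g (x + y * I)) (x + y * I)) :
    HasDerivAt (fun x : ℝ ↦ G (x + y * I)) (g (x + y * I)) x := by
  simpa [Function.comp_def] using
    h.scomp x ((hasDerivAt_id x).ofReal_comp.add_const (y * I))

theorem hasDerivAt_comp_add_mul_I_right {G : ℂ → E} (x y : ℝ)
    (h : HasDerivAt G (g (x + y * I)) (x + y * I)) :
    HasDerivAt (fun y : ℝ ↦ G (x + y * I)) (I • g (x + y * I)) y := by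
  simpa [Function.comp_def] using
    h.scomp y (((hasDerivAt_id y).ofReal_comp.mul_const I).const_add (x : ℂ))

theorem hankelIntegral_eq_zero_of_hasDerivAt [CompleteSpace E] {G : ℂ → E}
    (hG : ∀ s, HasDerivAt G (g s) s) (hg : HankelIntegrable g c a b)
    (ha : Tendsto (fun x : ℝ ↦ G (x + a * I)) atTop (𝓝 0))
    (hb : Tendsto (fun x : ℝ ↦ G (x + b * I)) atTop (𝓝 0)) :
    hankelIntegral g c a b = 0 := by
  have ray {y : ℝ} (hi : IntegrableOn (fun x : ℝ ↦ g (x + y * I)) (Ioi c))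
      (hy : Tendsto (fun x : ℝ ↦ G (x + y * I)) atTop (𝓝 0)) :
      ∫ x in Ioi c, g (x + y * I) = 0 - G (c + y * I) :=
    integral_Ioi_of_hasDerivAt_of_tendsto'
      (fun x _ ↦ hasDerivAt_comp_add_mul_I_left x y (hG _)) hi hy
  have side : I • ∫ y in a..b, g (c + y * I) = G (c + b * I) - G (c + a * I) := by
    rw [← intervalIntegral.integral_smul]
    exact intervalIntegral.integral_eq_sub_of_hasDerivAt
      (fun y _ ↦ hasDerivAt_comp_add_mul_I_right c y (hG _)) (hg.vertical.smul I)
  rw [hankelIntegral, side, ray hg.lower ha, ray hg.upper hb]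
  abel

theorem integral_rect_eq_zero_of_differentiable (hg : Differentiable ℂ g) (x₁ x₂ y₁ y₂ : ℝ) :
    (∫ x in x₁..x₂, g (x + y₁ * I)) - (∫ x in x₁..x₂, g (x + y₂ * I))
      + I • (∫ y in y₁..y₂, g (x₂ + y * I)) - I • (∫ y in y₁..y₂, g (x₁ + y * I)) = 0 := by
  simpa using integral_boundary_rect_eq_zero_of_differentiableOn g ⟨x₁, y₁⟩ ⟨x₂, y₂⟩
    hg.differentiableOn

theorem hankelIntegral_eq_zero_of_tendsto (hg : Differentiable ℂ g)
    (hi : HankelIntegrable g c a b)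
    (hside : Tendsto (fun x : ℝ ↦ ∫ y in a..b, g (x + y * I)) atTop (𝓝 0)) :
    hankelIntegral g c a b = 0 := by
  have hrect := ((intervalIntegral_tendsto_integral_Ioi c hi.lower tendsto_id).sub
    (intervalIntegral_tendsto_integral_Ioi c hi.upper tendsto_id)).add (hside.const_smul I)
      |>.sub_const (I • ∫ y in a..b, g (c + y * I))
  have hzero := tendsto_nhds_unique
    (hrect.congr fun x ↦ integral_rect_eq_zero_of_differentiable hg c x a b) tendsto_const_nhds
  rw [hankelIntegral, ← neg_eq_zero, ← hzero]
  module

theorem hankelIntegral_congr_re (hg : Differentiable ℂ g) (h : HankelIntegrable g c a b)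
    (h' : HankelIntegrable g c' a b) : hankelIntegral g c a b = hankelIntegral g c' a b := by
  have hrect := integral_rect_eq_zero_of_differentiable hg c c' a b
  rw [hankelIntegral, hankelIntegral,
    ← intervalIntegral.integral_interval_add_Ioi h.lower h'.lower,
    ← intervalIntegral.integral_interval_add_Ioi h.upper h'.upper]
  rw [← sub_eq_zero, ← neg_eq_zero, ← hrect]
  module

theorem hankelIntegral_add_adjacent_intervals (h : HankelIntegrable g c a b)
    (h' : HankelIntegrable g c b b') :
    hankelIntegral g c a b + hankelIntegral g c b b' = hankelIntegral g c a b' := by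
  rw [hankelIntegral, hankelIntegral, hankelIntegral,
    ← intervalIntegral.integral_add_adjacent_intervals h.vertical h'.vertical]
  module

end HankelContour

section HankelKernel

/-- The integrand of Hankel's integral `(2πi)⁻¹ ∫ e ^ ζ ζ ^ (-ν) dζ` for `1 / Γ(ν)`, in the
coordinate `s = log ζ`; the factor `dζ = ζ ds` is included. -/
def hankelKernel (ν s : ℂ) : ℂ :=
  exp (exp s + (1 - ν) * s)

theorem differentiable_hankelKernel (ν : ℂ) : Differentiable ℂ (hankelKernel ν) := by
  unfold hankelKernel
  fun_prop

theorem continuous_hankelKernel (ν : ℂ) : Continuous (hankelKernel ν) :=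
  (differentiable_hankelKernel ν).continuous

theorem norm_hankelKernel (ν : ℂ) (x y : ℝ) :
    ‖hankelKernel ν (x + y * I)‖ =
      Real.exp (Real.exp x * Real.cos y + (1 - ν.re) * x + ν.im * y) := by
  simp [hankelKernel, norm_exp, exp_re, add_assoc]

theorem exists_eventually_norm_hankelKernel_le (ν : ℂ) {K : Set ℝ} (hK : IsCompact K)
    (hcos : ∀ y ∈ K, Real.cos y < 0) :
    ∃ C, ∀ᶠ x : ℝ in atTop, ∀ y ∈ K, ‖hankelKernel ν (x + y * I)‖ ≤ C * Real.exp (-x) := by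
  obtain ⟨κ, hκ, hκcos⟩ : ∃ κ, 0 < κ ∧ ∀ y ∈ K, κ ≤ -Real.cos y :=
    hK.exists_forall_le' (by fun_prop) fun y hy ↦ neg_pos.2 (hcos y hy)
  obtain ⟨C, hC⟩ := hK.exists_bound_of_continuousOn
    (f := fun y ↦ Real.exp (ν.im * y)) (by fun_prop)
  refine ⟨C, ?_⟩
  filter_upwards [(Real.tendsto_exp_div_pow_atTop 1).eventually_ge_atTop ((2 - ν.re) / κ),
    eventually_gt_atTop 0] with x hx hx0 y hy
  have hgrowth : (2 - ν.re) * x ≤ κ * Real.exp x := by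
    rw [pow_one, div_le_div_iff₀ hκ hx0] at hx
    linarith
  calc ‖hankelKernel ν (x + y * I)‖
      = Real.exp (Real.exp x * Real.cos y + (1 - ν.re) * x + ν.im * y) := norm_hankelKernel ν x y
    _ ≤ Real.exp (ν.im * y + -x) :=
      Real.exp_le_exp.2 (by nlinarith [hκcos y hy, Real.exp_pos x])
    _ = Real.exp (ν.im * y) * Real.exp (-x) := Real.exp_add _ _
    _ ≤ C * Real.exp (-x) := by
      gcongr
      exact (le_abs_self _).trans (hC y hy)

theorem isBigO_hankelKernel_add_mul_I (ν : ℂ) {y : ℝ} (hy : Real.cos y < 0) :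
    (fun x : ℝ ↦ hankelKernel ν (x + y * I)) =O[atTop] fun x ↦ Real.exp (-1 * x) := by
  obtain ⟨C, hC⟩ := exists_eventually_norm_hankelKernel_le ν (isCompact_singleton (x := y))
    (by simpa using hy)
  refine .of_bound C (hC.mono fun x hx ↦ ?_)
  simpa using hx y rfl

theorem integrableOn_hankelKernel_add_mul_I (ν : ℂ) (c : ℝ) {y : ℝ} (hy : Real.cos y < 0) :
    IntegrableOn (fun x : ℝ ↦ hankelKernel ν (x + y * I)) (Ioi c) := by
  have hcont : Continuous fun x : ℝ ↦ hankelKernel ν (x + y * I) :=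
    (continuous_hankelKernel ν).comp (by fun_prop)
  exact (integrable_norm_iff hcont.aestronglyMeasurable).1 <| integrable_of_isBigO_exp_neg one_pos
    hcont.norm.continuousOn (isBigO_hankelKernel_add_mul_I ν hy).norm_left

theorem tendsto_hankelKernel_add_mul_I (ν : ℂ) {y : ℝ} (hy : Real.cos y < 0) :
    Tendsto (fun x : ℝ ↦ hankelKernel ν (x + y * I)) atTop (𝓝 0) :=
  (isBigO_hankelKernel_add_mul_I ν hy).trans_tendsto <| by
    simpa using Real.tendsto_exp_neg_atTop_nhds_zero

theorem tendsto_intervalIntegral_hankelKernel (ν : ℂ) {y₁ y₂ : ℝ}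
    (hcos : ∀ y ∈ uIcc y₁ y₂, Real.cos y < 0) :
    Tendsto (fun x : ℝ ↦ ∫ y in y₁..y₂, hankelKernel ν (x + y * I)) atTop (𝓝 0) := by
  obtain ⟨C, hC⟩ := exists_eventually_norm_hankelKernel_le ν isCompact_uIcc hcos
  have hbound : Tendsto (fun x : ℝ ↦ C * Real.exp (-x) * |y₂ - y₁|) atTop (𝓝 0) := by
    simpa using (Real.tendsto_exp_neg_atTop_nhds_zero.const_mul C).mul_const |y₂ - y₁|
  refine squeeze_zero_norm' (hC.mono fun x hx ↦ ?_) hbound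
  exact intervalIntegral.norm_integral_le_of_norm_le_const fun y hy ↦ hx y (uIoc_subset_uIcc hy)

theorem hankelIntegrable_hankelKernel (ν : ℂ) (c : ℝ) {a b : ℝ} (ha : Real.cos a < 0)
    (hb : Real.cos b < 0) : HankelIntegrable (hankelKernel ν) c a b where
  vertical := ((continuous_hankelKernel ν).comp (by fun_prop)).intervalIntegrable _ _
  lower := integrableOn_hankelKernel_add_mul_I ν c ha
  upper := integrableOn_hankelKernel_add_mul_I ν c hb

theorem hankelIntegral_hankelKernel_congr_re (ν : ℂ) (c c' : ℝ) {a b : ℝ} (ha : Real.cos a < 0)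
    (hb : Real.cos b < 0) :
    hankelIntegral (hankelKernel ν) c a b = hankelIntegral (hankelKernel ν) c' a b :=
  hankelIntegral_congr_re (differentiable_hankelKernel ν)
    (hankelIntegrable_hankelKernel ν c ha hb) (hankelIntegrable_hankelKernel ν c' ha hb)

theorem hankelIntegral_hankelKernel_eq_zero (ν : ℂ) (c : ℝ) {a b : ℝ}
    (hcos : ∀ y ∈ uIcc a b, Real.cos y < 0) : hankelIntegral (hankelKernel ν) c a b = 0 :=
  hankelIntegral_eq_zero_of_tendsto (differentiable_hankelKernel ν)
    (hankelIntegrable_hankelKernel ν c (hcos a left_mem_uIcc) (hcos b right_mem_uIcc))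
    (tendsto_intervalIntegral_hankelKernel ν hcos)

theorem hankelIntegral_hankelKernel_congr_im (ν : ℂ) (c : ℝ) {a b a' b' : ℝ}
    (ha : ∀ y ∈ uIcc a a', Real.cos y < 0) (hb : ∀ y ∈ uIcc b b', Real.cos y < 0) :
    hankelIntegral (hankelKernel ν) c a b = hankelIntegral (hankelKernel ν) c a' b' := by
  have hi {y₁ y₂ : ℝ} (h₁ : Real.cos y₁ < 0) (h₂ : Real.cos y₂ < 0) :=
    hankelIntegrable_hankelKernel ν c h₁ h₂
  have ha₁ := ha a left_mem_uIcc
  have ha₂ := ha a' right_mem_uIcc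
  have hb₁ := hb b left_mem_uIcc
  have hb₂ := hb b' right_mem_uIcc
  rw [← hankelIntegral_add_adjacent_intervals (hi ha₁ ha₂) (hi ha₂ hb₁),
    ← hankelIntegral_add_adjacent_intervals (hi ha₂ hb₁) (hi hb₁ hb₂),
    hankelIntegral_hankelKernel_eq_zero ν c ha, hankelIntegral_hankelKernel_eq_zero ν c hb,
    zero_add, add_zero]

theorem hankelIntegral_hankelKernel_eq_mul_add_one (ν : ℂ) (c : ℝ) {a b : ℝ}
    (ha : Real.cos a < 0) (hb : Real.cos b < 0) :
    hankelIntegral (hankelKernel ν) c a b =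
      ν * hankelIntegral (hankelKernel (ν + 1)) c a b := by
  have hderiv (s : ℂ) :
      HasDerivAt (hankelKernel (ν + 1)) ((hankelKernel ν - ν • hankelKernel (ν + 1)) s) s := by
    have hmul : hankelKernel ν s = exp s * hankelKernel (ν + 1) s := by
      rw [hankelKernel, hankelKernel, ← exp_add]
      ring_nf
    refine ((hasDerivAt_exp s).add ((hasDerivAt_id s).const_mul (1 - (ν + 1)))).cexp.congr_deriv ?_
    simp only [Pi.sub_apply, Pi.smul_apply, Pi.add_apply, id, smul_eq_mul, hmul]
    rw [hankelKernel]
    ring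
  have hi := hankelIntegrable_hankelKernel ν c ha hb
  have hi' := (hankelIntegrable_hankelKernel (ν + 1) c ha hb).const_smul ν
  have hzero := hankelIntegral_eq_zero_of_hasDerivAt hderiv (hi.sub hi')
    (tendsto_hankelKernel_add_mul_I (ν + 1) ha) (tendsto_hankelKernel_add_mul_I (ν + 1) hb)
  rwa [hankelIntegral_sub hi hi', hankelIntegral_const_smul, smul_eq_mul, sub_eq_zero] at hzero

end HankelKernel

section HankelFormula

theorem exp_smul_gammaIntegrand_exp (s : ℂ) (x : ℝ) :
    Real.exp x • ((Real.exp (-Real.exp x) : ℂ) * (Real.exp x : ℂ) ^ (s - 1)) =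
      exp (-exp x + s * x) := by
  rw [cpow_def_of_ne_zero (ofReal_ne_zero.2 (Real.exp_pos x).ne'),
    ← ofReal_log (Real.exp_pos x).le, Real.log_exp, real_smul]
  push_cast
  rw [← exp_add, ← exp_add]
  ring_nf

theorem integrable_exp_neg_exp_add_mul {s : ℂ} (hs : 0 < s.re) :
    Integrable fun x : ℝ ↦ exp (-exp x + s * x) := by
  have h := GammaIntegral_convergent hs
  rw [← Real.range_exp, ← image_univ, integrableOn_image_iff_integrableOn_deriv_smul_of_monotoneOn
    .univ (fun x _ ↦ (Real.hasDerivAt_exp x).hasDerivWithinAt) (Real.exp_monotone.monotoneOn _),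
    integrableOn_univ] at h
  simpa only [exp_smul_gammaIntegrand_exp] using h

theorem integral_exp_neg_exp_add_mul {s : ℂ} (hs : 0 < s.re) :
    ∫ x : ℝ, exp (-exp x + s * x) = Gamma s := by
  rw [Gamma_eq_integral hs, GammaIntegral, ← Real.range_exp, ← image_univ,
    integral_image_eq_integral_deriv_smul_of_monotoneOn .univ
      (fun x _ ↦ (Real.hasDerivAt_exp x).hasDerivWithinAt) (Real.exp_monotone.monotoneOn _),
    setIntegral_univ]
  simp only [exp_smul_gammaIntegrand_exp]

theorem hankelKernel_add_mul_I_of_exp_eq_neg_one (ν : ℂ) {y : ℝ} (hy : exp (y * I) = -1) (x : ℝ) :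
    hankelKernel ν (x + y * I) = exp (-exp x + (1 - ν) * x) * exp ((1 - ν) * y * I) := by
  rw [hankelKernel, exp_add (x : ℂ), hy, ← exp_add]
  ring_nf

theorem exp_neg_pi_mul_I : exp ((-π : ℝ) * I) = -1 := by
  rw [ofReal_neg, neg_mul, exp_neg, exp_pi_mul_I, inv_neg_one]

theorem exp_sub_exp_mul_Gamma_one_sub {ν : ℂ} (hν : ν.re < 1) :
    (exp ((1 - ν) * π * I) - exp ((1 - ν) * (-π : ℝ) * I)) * Gamma (1 - ν) =
      2 * π * I / Gamma ν := by
  have hΓ : Gamma (1 - ν) ≠ 0 := Gamma_ne_zero_of_re_pos (by simpa using hν)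
  have hsin : exp ((1 - ν) * π * I) - exp ((1 - ν) * (-π : ℝ) * I) = 2 * I * sin (π * ν) := by
    rw [← sin_pi_sub, sin]
    push_cast
    ring_nf
    simp only [I_sq]
    ring
  have hrefl : (Gamma ν)⁻¹ = sin (π * ν) / π * Gamma (1 - ν) := by
    rw [← inv_div, ← Gamma_mul_Gamma_one_sub, mul_inv, inv_mul_cancel_right₀ hΓ]
  rw [hsin, div_eq_mul_inv, hrefl]
  field [Real.pi_ne_zero]

theorem tendsto_intervalIntegral_hankelKernel_atBot {ν : ℂ} (hν : ν.re < 1) (a b : ℝ) :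
    Tendsto (fun x : ℝ ↦ ∫ y in a..b, hankelKernel ν (x + y * I)) atBot (𝓝 0) := by
  obtain ⟨C, hC⟩ := isCompact_uIcc.exists_bound_of_continuousOn (s := uIcc a b)
    (f := fun y ↦ Real.exp (ν.im * y)) (by fun_prop)
  have hexp : Tendsto (fun x : ℝ ↦ Real.exp (Real.exp x + (1 - ν.re) * x)) atBot (𝓝 0) :=
    Real.tendsto_exp_atBot.comp <| Real.tendsto_exp_atBot.add_atBot <|
      tendsto_id.const_mul_atBot (sub_pos.2 hν)
  have hbound : Tendsto (fun x : ℝ ↦ Real.exp (Real.exp x + (1 - ν.re) * x) * C * |b - a|)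
      atBot (𝓝 0) := by
    simpa using (hexp.mul_const C).mul_const |b - a|
  refine squeeze_zero_norm (fun x ↦ ?_) hbound
  refine intervalIntegral.norm_integral_le_of_norm_le_const fun y hy ↦ ?_
  rw [norm_hankelKernel, Real.exp_add]
  gcongr
  · exact mul_le_of_le_one_right (Real.exp_pos x).le (Real.cos_le_one y)
  · exact (le_abs_self _).trans (hC y (uIoc_subset_uIcc hy))

theorem hankelIntegral_pi_of_re_lt_one {ν : ℂ} (hν : ν.re < 1) (c : ℝ) :
    hankelIntegral (hankelKernel ν) c (-π) π = 2 * π * I / Gamma ν := by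
  have hray : Tendsto (fun x : ℝ ↦ ∫ u in Ioi x, exp (-exp u + (1 - ν) * u)) atBot
      (𝓝 (Gamma (1 - ν))) := by
    have hre : 0 < (1 - ν).re := by simpa using hν
    rw [← integral_exp_neg_exp_add_mul hre]
    exact (aecover_Ioi tendsto_id).integral_tendsto_of_countably_generated
      (integrable_exp_neg_exp_add_mul hre)
  have hlim := ((tendsto_intervalIntegral_hankelKernel_atBot hν (-π) π).const_smul I).add
    (hray.const_mul (exp ((1 - ν) * π * I) - exp ((1 - ν) * (-π : ℝ) * I)))
  rw [smul_zero, zero_add, exp_sub_exp_mul_Gamma_one_sub hν] at hlim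
  refine (tendsto_nhds_unique (hlim.congr fun x ↦ ?_) tendsto_const_nhds).symm
  rw [hankelIntegral_hankelKernel_congr_re ν c x (by simp) (by simp), hankelIntegral]
  simp only [hankelKernel_add_mul_I_of_exp_eq_neg_one ν exp_pi_mul_I,
    hankelKernel_add_mul_I_of_exp_eq_neg_one ν exp_neg_pi_mul_I, integral_mul_const]
  ring

theorem hankelIntegral_pi_one (c : ℝ) :
    hankelIntegral (hankelKernel 1) c (-π) π = 2 * π * I := by
  have hmean : Real.circleAverage exp 0 (Real.exp c) = 1 := by
    rw [(differentiable_exp.diffContOnCl).circleAverage, exp_zero]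
  have hside : ∫ y in (-π)..π, hankelKernel 1 (c + y * I) = 2 * π := by
    rw [Real.circleAverage_eq_integral_add (-π), intervalIntegral.integral_comp_add_right
      (fun y ↦ exp (circleMap 0 (Real.exp c) y)), zero_add, two_mul, add_neg_cancel_right,
      inv_smul_eq_iff₀ (by positivity)] at hmean
    simpa [hankelKernel, circleMap, exp_add, two_mul] using hmean
  rw [hankelIntegral, hside]
  simp only [hankelKernel_add_mul_I_of_exp_eq_neg_one 1 exp_pi_mul_I,
    hankelKernel_add_mul_I_of_exp_eq_neg_one 1 exp_neg_pi_mul_I, smul_eq_mul]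
  simp [mul_comm]

theorem hankelIntegral_pi_of_re_lt_one_add_nat {ν : ℂ} (n : ℕ) (hν : ν.re < 1 + n) (c : ℝ) :
    hankelIntegral (hankelKernel ν) c (-π) π = 2 * π * I / Gamma ν := by
  induction n generalizing ν with
  | zero => exact hankelIntegral_pi_of_re_lt_one (by simpa using hν) c
  | succ n ih =>
    obtain rfl | hν1 := eq_or_ne ν 1
    -- At `ν = 1` the recursion reads `0 = 0`; there the vertical side is a circle mean of `exp`.
    · rw [hankelIntegral_pi_one, Gamma_one, div_one]
    · have hrec := hankelIntegral_hankelKernel_eq_mul_add_one (ν - 1) c (a := -π) (b := π)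
        (by simp) (by simp)
      rw [ih (by push_cast at hν; simp; linarith), div_eq_mul_inv,
        one_div_Gamma_eq_self_mul_one_div_Gamma_add_one, sub_add_cancel] at hrec
      exact mul_left_cancel₀ (sub_ne_zero.2 hν1) (by linear_combination -hrec)

theorem cos_neg_of_abs_sub_pi_lt {y : ℝ} (hy : |y - π| < π / 2) : Real.cos y < 0 := by
  rw [abs_lt] at hy
  exact Real.cos_neg_of_pi_div_two_lt_of_lt (by linarith) (by linarith)

theorem cos_neg_of_abs_add_pi_lt {y : ℝ} (hy : |y + π| < π / 2) : Real.cos y < 0 := by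
  rw [← Real.cos_neg]
  exact cos_neg_of_abs_sub_pi_lt (by rwa [← neg_add', abs_neg])

theorem hankelIntegral_hankelKernel (ν : ℂ) (c : ℝ) {a b : ℝ} (ha : |a + π| < π / 2)
    (hb : |b - π| < π / 2) :
    hankelIntegral (hankelKernel ν) c a b = 2 * π * I / Gamma ν := by
  obtain ⟨n, hn⟩ := exists_nat_gt (ν.re - 1)
  rw [← hankelIntegral_pi_of_re_lt_one_add_nat n (by linarith) c]
  refine (hankelIntegral_hankelKernel_congr_im ν c (fun y hy ↦ ?_) fun y hy ↦ ?_).symm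
  · have hya := abs_sub_left_of_mem_uIcc hy
    rw [sub_neg_eq_add, sub_neg_eq_add] at hya
    exact cos_neg_of_abs_add_pi_lt (hya.trans_lt ha)
  · exact cos_neg_of_abs_sub_pi_lt ((abs_sub_left_of_mem_uIcc hy).trans_lt hb)

end HankelFormula

section GeometricSeries

variable {α 𝕜 : Type*} [MeasurableSpace α] {m : Measure α} [RCLike 𝕜] {F w : α → 𝕜} {q : ℝ}

theorem integrable_div_one_sub (hF : Integrable F m) (hw : AEStronglyMeasurable w m) (hq : q < 1)
    (hwq : ∀ᵐ x ∂m, ‖w x‖ ≤ q) : Integrable (fun x ↦ F x / (1 - w x)) m := by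
  simp only [div_eq_mul_inv]
  refine hF.mul_bdd (c := (1 - q)⁻¹)
    (aestronglyMeasurable_const.sub hw).aemeasurable.inv.aestronglyMeasurable ?_
  filter_upwards [hwq] with x hx
  have hle : 1 - q ≤ ‖1 - w x‖ := by
    have := norm_sub_norm_le (1 : 𝕜) (w x)
    rw [norm_one] at this
    linarith
  rw [norm_inv]
  exact inv_anti₀ (sub_pos.2 hq) hle

theorem hasSum_integral_mul_pow (hF : Integrable F m) (hw : AEStronglyMeasurable w m) (hq : q < 1)
    (hwq : ∀ᵐ x ∂m, ‖w x‖ ≤ q) :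
    HasSum (fun k : ℕ ↦ ∫ x, F x * w x ^ k ∂m) (∫ x, F x / (1 - w x) ∂m) := by
  have hlt : ∀ᵐ x ∂m, ‖w x‖ < 1 := hwq.mono fun x hx ↦ hx.trans_lt hq
  refine hasSum_integral_of_dominated_convergence (fun k x ↦ ‖F x‖ * ‖w x‖ ^ k)
    (fun k ↦ hF.aestronglyMeasurable.mul (hw.pow k)) (fun k ↦ .of_forall fun x ↦ ?_) ?_ ?_ ?_
  · rw [norm_mul, norm_pow]
  · exact hlt.mono fun x hx ↦ (summable_geometric_of_lt_one (norm_nonneg _) hx).mul_left _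
  · refine (integrable_div_one_sub hF.norm hw.norm hq (by simpa using hwq)).congr ?_
    filter_upwards [hlt] with x hx
    rw [tsum_mul_left, tsum_geometric_of_lt_one (norm_nonneg _) hx, div_eq_mul_inv]
  · exact hlt.mono fun x hx ↦ by
      simpa only [div_eq_mul_inv] using (hasSum_geometric_of_norm_lt_one hx).mul_left (F x)

end GeometricSeries

section HankelGeometricSeries

variable {F w : ℂ → ℂ} {q c a b : ℝ}

theorem HankelIntegrable.div_one_sub (hF : HankelIntegrable F c a b) (hw : Continuous w)
    (hq : q < 1) (hwq : ∀ s : ℂ, c ≤ s.re → ‖w s‖ ≤ q) :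
    HankelIntegrable (fun s ↦ F s / (1 - w s)) c a b where
  vertical := intervalIntegrable_iff.2 <| integrable_div_one_sub hF.vertical.def'
    (by fun_prop) hq (.of_forall fun y ↦ hwq _ (by simp))
  lower := integrable_div_one_sub hF.lower (by fun_prop) hq <|
    ae_restrict_of_forall_mem measurableSet_Ioi fun x hx ↦ hwq _ (by simpa using le_of_lt hx)
  upper := integrable_div_one_sub hF.upper (by fun_prop) hq <|
    ae_restrict_of_forall_mem measurableSet_Ioi fun x hx ↦ hwq _ (by simpa using le_of_lt hx)

theorem hasSum_hankelIntegral_mul_pow (hF : HankelIntegrable F c a b) (hab : a ≤ b)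
    (hw : Continuous w) (hq : q < 1) (hwq : ∀ s : ℂ, c ≤ s.re → ‖w s‖ ≤ q) :
    HasSum (fun k : ℕ ↦ hankelIntegral (fun s ↦ F s * w s ^ k) c a b)
      (hankelIntegral (fun s ↦ F s / (1 - w s)) c a b) := by
  have hside := hasSum_integral_mul_pow
    ((intervalIntegrable_iff_integrableOn_Ioc_of_le hab).1 hF.vertical)
    (w := fun y : ℝ ↦ w (c + y * I)) (by fun_prop) hq (.of_forall fun y ↦ hwq _ (by simp))
  have hray {y : ℝ} (h : IntegrableOn (fun x : ℝ ↦ F (x + y * I)) (Ioi c)) :=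
    hasSum_integral_mul_pow h (w := fun x : ℝ ↦ w (x + y * I)) (by fun_prop) hq <|
      ae_restrict_of_forall_mem measurableSet_Ioi fun x hx ↦ hwq _ (by simpa using le_of_lt hx)
  simp only [hankelIntegral, intervalIntegral.integral_of_le hab]
  exact ((hside.const_smul I).add (hray hF.upper)).sub (hray hF.lower)

end HankelGeometricSeries

section MittagLefflerKernel

variable {ρ a b c : ℝ} {z : ℂ}

/-- The integrand of the Hankel-type representation of `E_{ρ,μ}(z)`: the sum over `k` of
`z ^ k * hankelKernel (μ + k / ρ) s`, a geometric series. -/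
def mittagLefflerKernel (ρ : ℝ) (μ z s : ℂ) : ℂ :=
  hankelKernel μ s / (1 - z * exp (-s / ρ))

theorem hankelKernel_mul_pow (ρ : ℝ) (μ z s : ℂ) (k : ℕ) :
    hankelKernel μ s * (z * exp (-s / ρ)) ^ k = z ^ k * hankelKernel (μ + (k : ℂ) / (ρ : ℂ)) s := by
  rw [hankelKernel, hankelKernel, mul_pow, ← exp_nat_mul, mul_left_comm, ← exp_add]
  ring_nf

theorem norm_mul_exp_neg_div_le (hρ : 0 ≤ ρ) (z : ℂ) {s : ℂ} (hs : c ≤ s.re) :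
    ‖z * exp (-s / ρ)‖ ≤ ‖z‖ * Real.exp (-c / ρ) := by
  rw [norm_mul, norm_exp, div_ofReal_re, neg_re]
  gcongr

theorem hankelIntegrable_mittagLefflerKernel (hρ : 0 ≤ ρ) (μ : ℂ)
    (hz : ‖z‖ * Real.exp (-c / ρ) < 1) (ha : Real.cos a < 0) (hb : Real.cos b < 0) :
    HankelIntegrable (mittagLefflerKernel ρ μ z) c a b :=
  (hankelIntegrable_hankelKernel μ c ha hb).div_one_sub (by fun_prop) hz
    fun _ ↦ norm_mul_exp_neg_div_le hρ z

theorem hasSum_mittagLefflerTerm (hρ : 0 ≤ ρ) (μ : ℂ) (hz : ‖z‖ * Real.exp (-c / ρ) < 1)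
    (ha : |a + π| < π / 2) (hb : |b - π| < π / 2) :
    HasSum (mittagLefflerTerm ρ μ z)
      (hankelIntegral (mittagLefflerKernel ρ μ z) c a b / (2 * π * I)) := by
  have hab : a ≤ b := by
    linarith [(abs_lt.1 ha).2, (abs_lt.1 hb).1, Real.pi_pos]
  have hterm (k : ℕ) : mittagLefflerTerm ρ μ z k =
      hankelIntegral (fun s ↦ hankelKernel μ s * (z * exp (-s / ρ)) ^ k) c a b / (2 * π * I) := by
    have hsmul : (fun s ↦ hankelKernel μ s * (z * exp (-s / ρ)) ^ k) =
        z ^ k • hankelKernel (μ + (k : ℂ) / (ρ : ℂ)) :=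
      funext fun s ↦ hankelKernel_mul_pow ρ μ z s k
    rw [hsmul, hankelIntegral_const_smul, hankelIntegral_hankelKernel _ c ha hb, smul_eq_mul,
      mittagLefflerTerm, mul_div_assoc, div_div_cancel_left' two_pi_I_ne_zero, div_eq_mul_inv]
  exact ((hasSum_hankelIntegral_mul_pow (hankelIntegrable_hankelKernel μ c
    (cos_neg_of_abs_add_pi_lt ha) (cos_neg_of_abs_sub_pi_lt hb)) hab (by fun_prop) hz
    fun _ ↦ norm_mul_exp_neg_div_le hρ z).div_const (2 * π * I)).congr_fun hterm

theorem summable_mittagLefflerTerm (hρ : 0 < ρ) (μ z : ℂ) : Summable (mittagLefflerTerm ρ μ z) := by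
  have hlim : Tendsto (fun c : ℝ ↦ ‖z‖ * Real.exp (-c / ρ)) atTop (𝓝 0) := by
    simpa [neg_div] using (Real.tendsto_exp_neg_atTop_nhds_zero.comp
      (tendsto_id.atTop_div_const hρ)).const_mul ‖z‖
  obtain ⟨c, hc⟩ := (hlim.eventually_lt_const one_pos).exists
  exact (hasSum_mittagLefflerTerm hρ.le μ hc (a := -π) (b := π) (by simp [Real.pi_pos])
    (by simp [Real.pi_pos])).summable

end MittagLefflerKernel

section LogSubstitution

variable {E : Type*} [NormedAddCommGroup E] [NormedSpace ℝ E] {ρ t R : ℝ}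

theorem div_smul_eq_smul_inv_mul_smul (ht : t ≠ 0) (r : ℝ) (v : E) :
    (ρ / r) • v = t • (t * r)⁻¹ • ρ • v := by
  rw [smul_smul, smul_smul]
  congr 1
  field

theorem integral_Ioi_comp_mul_log_mul (hρ : 0 < ρ) (ht : 0 < t) (hR : 0 < R) (g : ℝ → E) :
    ∫ r in Ioi R, (ρ / r) • g (ρ * Real.log (t * r)) = ∫ x in Ioi (ρ * Real.log (t * R)), g x := by
  simp only [div_smul_eq_smul_inv_mul_smul ht.ne']
  rw [integral_smul, integral_comp_mul_left_Ioi' (fun r ↦ r⁻¹ • ρ • g (ρ * Real.log r)) R ht,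
    integral_comp_log_Ioi (fun y ↦ ρ • g (ρ * y)) (mul_pos ht hR), integral_smul,
    integral_comp_mul_left_Ioi' g _ hρ]

theorem integrableOn_Ioi_comp_mul_log_mul_iff (hρ : 0 < ρ) (ht : 0 < t) (hR : 0 < R) (g : ℝ → E) :
    IntegrableOn (fun r ↦ (ρ / r) • g (ρ * Real.log (t * r))) (Ioi R) ↔
      IntegrableOn g (Ioi (ρ * Real.log (t * R))) := by
  simp only [div_smul_eq_smul_inv_mul_smul ht.ne']
  rw [IntegrableOn, integrable_fun_smul_iff ht.ne', ← IntegrableOn,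
    integrableOn_Ioi_comp_mul_left_iff (fun r ↦ r⁻¹ • ρ • g (ρ * Real.log r)) R ht,
    integrableOn_comp_log_Ioi (fun y ↦ ρ • g (ρ * y)) (mul_pos ht hR), IntegrableOn,
    integrable_fun_smul_iff hρ.ne', ← IntegrableOn, integrableOn_Ioi_comp_mul_left_iff g _ hρ]

end LogSubstitution

section PolarCoordinates

variable {ρ r t : ℝ} {μ : ℂ} {δ θ φ : ℝ}

/-- The point `s = ρ (log (t r) + i (θ + φ))` of the logarithmic plane of `hankelIntegral`, that
is, `ζ = e ^ s` equals `(z r e ^ (iφ)) ^ ρ` for `z = t e ^ (iθ)`. -/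
def logPolar (ρ t θ r φ : ℝ) : ℂ :=
  (ρ * Real.log (t * r) : ℝ) + (ρ * (θ + φ) : ℝ) * I

/-- The complex kernel `P = P^{Re} + i P^{Im}`. -/
def mlP (ρ : ℝ) (μ : ℂ) (r φ t θ : ℝ) : ℂ :=
  mlPRe ρ μ r φ t θ + I * mlPIm ρ μ r φ t θ

/-- The complex kernel `K = K^{Re} + i K^{Im}`. -/
def mlK (ρ : ℝ) (μ : ℂ) (r δ t θ : ℝ) : ℂ :=
  mlKRe ρ μ r δ t θ + I * mlKIm ρ μ r δ t θ

theorem normSq_ofReal_sub_exp (r φ : ℝ) :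
    normSq (r - exp (φ * I)) = r ^ 2 - 2 * r * Real.cos φ + 1 := by
  simp only [normSq_apply, sub_re, sub_im, ofReal_re, ofReal_im, exp_ofReal_mul_I_re,
    exp_ofReal_mul_I_im]
  linear_combination Real.sin_sq_add_cos_sq φ

theorem inv_one_sub_inv_mul_exp (hr : r ≠ 0) (φ : ℝ) :
    (1 - (r : ℂ)⁻¹ * exp (-(φ * I)))⁻¹ =
      r * (r - exp (φ * I)) / (r ^ 2 - 2 * r * Real.cos φ + 1 : ℝ) := by
  have hr' : (r : ℂ) ≠ 0 := ofReal_ne_zero.2 hr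
  have hconj : 1 - (r : ℂ)⁻¹ * exp (-(φ * I)) =
      (r : ℂ)⁻¹ * (starRingEnd ℂ) (r - exp (φ * I)) := by
    rw [map_sub, conj_ofReal, ← exp_conj, map_mul, conj_ofReal, conj_I, mul_neg, mul_sub,
      inv_mul_cancel₀ hr']
  rw [hconj, mul_inv, inv_inv, inv_def, conj_conj, normSq_conj, normSq_ofReal_sub_exp, ofReal_inv,
    mul_div_assoc, div_eq_mul_inv]

theorem hankelKernel_logPolar (ρ : ℝ) (htr : 0 < t * r) (μ : ℂ) (θ φ : ℝ) :
    hankelKernel μ (logPolar ρ t θ r φ) =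
      ((t * r) ^ (ρ * (1 - μ.re)) * mlF ρ μ r φ t θ : ℝ) * exp (mlXi ρ μ r φ t θ * I) := by
  have hexp : exp (logPolar ρ t θ r φ) =
      ((t * r) ^ ρ : ℝ) * (Real.cos (ρ * (θ + φ)) + Real.sin (ρ * (θ + φ)) * I) := by
    rw [logPolar, exp_add, ← ofReal_exp, mul_comm ρ, ← Real.rpow_def_of_pos htr, exp_mul_I,
      ← ofReal_cos, ← ofReal_sin]
  rw [hankelKernel, hexp, logPolar, Real.rpow_def_of_pos htr (ρ * (1 - μ.re)), mlF, ← Real.exp_add,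
    ofReal_exp, ← exp_add]
  congr 1
  apply Complex.ext
  · simp [-ofReal_cos, -ofReal_sin]
    ring
  · simp [mlXi, -ofReal_cos, -ofReal_sin]
    ring

theorem mul_exp_neg_logPolar_div (hρ : ρ ≠ 0) (ht : 0 < t) (hr : 0 < r) (θ φ : ℝ) :
    t * exp (I * θ) * exp (-logPolar ρ t θ r φ / ρ) = (r : ℂ)⁻¹ * exp (-(φ * I)) := by
  have hρ' : (ρ : ℂ) ≠ 0 := ofReal_ne_zero.2 hρ
  have ht' : (t : ℂ) ≠ 0 := ofReal_ne_zero.2 ht.ne'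
  have hlog : exp (-logPolar ρ t θ r φ / ρ) =
      (t * r : ℂ)⁻¹ * exp (-(I * θ)) * exp (-(φ * I)) := by
    rw [← ofReal_mul, ← Real.exp_log (mul_pos ht hr), ofReal_exp, ← exp_neg, ← exp_add, ← exp_add,
      logPolar]
    congr 1
    push_cast
    field
  rw [hlog, exp_neg (I * θ)]
  field [exp_ne_zero (I * θ)]

theorem exp_mul_I_mul_sub_exp_mul_I (r ξ φ : ℝ) :
    exp (ξ * I) * (r - exp (φ * I)) =
      (r * Real.cos ξ - Real.cos (ξ + φ) : ℝ) + I * (r * Real.sin ξ - Real.sin (ξ + φ) : ℝ) := by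
  rw [mul_sub, ← exp_add, ← add_mul, exp_mul_I, exp_mul_I]
  push_cast
  ring

theorem mlP_eq_mittagLefflerKernel (hρ : ρ ≠ 0) (ht : 0 < t) (hr : 0 < r) (μ : ℂ) (φ θ : ℝ) :
    mlP ρ μ r φ t θ =
      (ρ / (2 * π)) * mittagLefflerKernel ρ μ (t * exp (I * θ)) (logPolar ρ t θ r φ) := by
  rw [mittagLefflerKernel, hankelKernel_logPolar ρ (mul_pos ht hr), div_eq_mul_inv _ (1 - _),
    mul_exp_neg_logPolar_div hρ ht hr, inv_one_sub_inv_mul_exp hr.ne', mul_div_right_comm,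
    mul_mul_mul_comm, exp_mul_I_mul_sub_exp_mul_I, mlP, mlPRe, mlPIm]
  push_cast
  ring

theorem mlPRe_sub_mlPRe (ρ : ℝ) (μ : ℂ) (r δ t θ : ℝ) :
    mlPRe ρ μ r (δ - π) t θ - mlPRe ρ μ r (-δ - π) t θ = -(r * mlKIm ρ μ r δ t θ) := by
  simp only [mlKIm, mlPRe, ← add_sub_assoc, Real.cos_sub_pi, Real.cos_neg, ← sub_eq_add_neg,
    mul_neg, sub_neg_eq_add]
  ring

theorem mlPIm_sub_mlPIm (ρ : ℝ) (μ : ℂ) (r δ t θ : ℝ) :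
    mlPIm ρ μ r (δ - π) t θ - mlPIm ρ μ r (-δ - π) t θ = r * mlKRe ρ μ r δ t θ := by
  simp only [mlKRe, mlPIm, ← add_sub_assoc, Real.cos_sub_pi, Real.sin_sub_pi, Real.cos_neg,
    ← sub_eq_add_neg, mul_neg, sub_neg_eq_add]
  ring

theorem mlP_sub_mlP (ρ : ℝ) (μ : ℂ) (r δ t θ : ℝ) :
    mlP ρ μ r (δ - π) t θ - mlP ρ μ r (-δ - π) t θ = r * I * mlK ρ μ r δ t θ := by
  have hre := congrArg ofReal (mlPRe_sub_mlPRe ρ μ r δ t θ)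
  have him := congrArg ofReal (mlPIm_sub_mlPIm ρ μ r δ t θ)
  push_cast at hre him
  rw [mlP, mlP, mlK]
  linear_combination hre + I * him - r * mlKIm ρ μ r δ t θ * I_sq

theorem mlK_eq_mittagLefflerKernel (hρ : ρ ≠ 0) (ht : 0 < t) (hr : 0 < r) (μ : ℂ) (δ θ : ℝ) :
    mlK ρ μ r δ t θ =
      ((ρ / r) • mittagLefflerKernel ρ μ (t * exp (I * θ)) (logPolar ρ t θ r (δ - π))
        - (ρ / r) • mittagLefflerKernel ρ μ (t * exp (I * θ)) (logPolar ρ t θ r (-δ - π)))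
        / (2 * π * I) := by
  have hr' : (r : ℂ) ≠ 0 := ofReal_ne_zero.2 hr.ne'
  calc mlK ρ μ r δ t θ
      = (mlP ρ μ r (δ - π) t θ - mlP ρ μ r (-δ - π) t θ) / (r * I) := by
        rw [mlP_sub_mlP, mul_div_cancel_left₀ _ (mul_ne_zero hr' I_ne_zero)]
    _ = _ := by
        rw [mlP_eq_mittagLefflerKernel hρ ht hr, mlP_eq_mittagLefflerKernel hρ ht hr, real_smul,
          real_smul]
        push_cast
        ring

end PolarCoordinates

section PolarContour

variable {ρ t R θ φ₁ φ₂ δ : ℝ} {μ : ℂ}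

theorem norm_mul_exp_mul_exp_neg_log_lt_one (hρ : ρ ≠ 0) (ht : 0 < t) (hR : 1 < R) (θ : ℝ) :
    ‖t * exp (I * θ)‖ * Real.exp (-(ρ * Real.log (t * R)) / ρ) < 1 := by
  have htR : 0 < t * R := mul_pos ht (one_pos.trans hR)
  rw [norm_mul, norm_exp_I_mul_ofReal, mul_one, norm_real, Real.norm_of_nonneg ht.le, neg_div,
    mul_div_cancel_left₀ _ hρ, Real.exp_neg, Real.exp_log htR, ← div_eq_mul_inv, div_lt_one htR]
  exact lt_mul_of_one_lt_right ht hR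

theorem intervalIntegrable_mlP (hρ : ρ ≠ 0) (ht : 0 < t) (hR : 0 < R)
    (hk : HankelIntegrable (mittagLefflerKernel ρ μ (t * exp (I * θ))) (ρ * Real.log (t * R))
      (ρ * (θ + φ₁)) (ρ * (θ + φ₂))) :
    IntervalIntegrable (fun φ ↦ mlP ρ μ R φ t θ) volume φ₁ φ₂ := by
  have h := (hk.vertical.comp_mul_left (c := ρ)).comp_add_left θ
  rw [mul_div_cancel_left₀ _ hρ, mul_div_cancel_left₀ _ hρ, add_sub_cancel_left,
    add_sub_cancel_left] at h
  simp only [mlP_eq_mittagLefflerKernel hρ ht hR]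
  exact h.const_mul _

theorem integral_mlP (hρ : ρ ≠ 0) (ht : 0 < t) (hR : 0 < R) (μ : ℂ) (θ φ₁ φ₂ : ℝ) :
    ∫ φ in φ₁..φ₂, mlP ρ μ R φ t θ =
      I • (∫ y in (ρ * (θ + φ₁))..(ρ * (θ + φ₂)),
        mittagLefflerKernel ρ μ (t * exp (I * θ)) ((ρ * Real.log (t * R) : ℝ) + y * I))
        / (2 * π * I) := by
  simp only [mlP_eq_mittagLefflerKernel hρ ht hR]
  rw [intervalIntegral.integral_const_mul, mul_add, mul_add,
    ← intervalIntegral.smul_integral_comp_add_mul]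
  simp only [logPolar, ← mul_add, real_smul, smul_eq_mul]
  field

theorem integrableOn_mlK (hρ : 0 < ρ) (ht : 0 < t) (hR : 0 < R)
    (hk : HankelIntegrable (mittagLefflerKernel ρ μ (t * exp (I * θ))) (ρ * Real.log (t * R))
      (ρ * (θ + (-δ - π))) (ρ * (θ + (δ - π)))) :
    IntegrableOn (fun r ↦ mlK ρ μ r δ t θ) (Ioi R) := by
  have hmlK : EqOn (fun r ↦ mlK ρ μ r δ t θ) _ (Ioi R) := fun r hr ↦
    mlK_eq_mittagLefflerKernel hρ.ne' ht (hR.trans hr) μ δ θ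
  rw [integrableOn_congr_fun hmlK measurableSet_Ioi]
  exact (((integrableOn_Ioi_comp_mul_log_mul_iff hρ ht hR _).2 hk.upper).sub
    ((integrableOn_Ioi_comp_mul_log_mul_iff hρ ht hR _).2 hk.lower)).div_const _

theorem integral_mlK (hρ : 0 < ρ) (ht : 0 < t) (hR : 0 < R)
    (hk : HankelIntegrable (mittagLefflerKernel ρ μ (t * exp (I * θ))) (ρ * Real.log (t * R))
      (ρ * (θ + (-δ - π))) (ρ * (θ + (δ - π)))) :
    ∫ r in Ioi R, mlK ρ μ r δ t θ =
      ((∫ x in Ioi (ρ * Real.log (t * R)),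
          mittagLefflerKernel ρ μ (t * exp (I * θ)) (x + (ρ * (θ + (δ - π)) : ℝ) * I))
        - ∫ x in Ioi (ρ * Real.log (t * R)),
          mittagLefflerKernel ρ μ (t * exp (I * θ)) (x + (ρ * (θ + (-δ - π)) : ℝ) * I))
        / (2 * π * I) := by
  have hmlK : EqOn (fun r ↦ mlK ρ μ r δ t θ) _ (Ioi R) := fun r hr ↦
    mlK_eq_mittagLefflerKernel hρ.ne' ht (hR.trans hr) μ δ θ
  rw [setIntegral_congr_fun measurableSet_Ioi hmlK, integral_div,
    ← integral_Ioi_comp_mul_log_mul hρ ht hR, ← integral_Ioi_comp_mul_log_mul hρ ht hR,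
    ← integral_sub ((integrableOn_Ioi_comp_mul_log_mul_iff hρ ht hR _).2 hk.upper)
      ((integrableOn_Ioi_comp_mul_log_mul_iff hρ ht hR _).2 hk.lower)]
  rfl

theorem hankelIntegral_mittagLefflerKernel_div (hρ : 0 < ρ) (ht : 0 < t) (hR : 0 < R)
    (hk : HankelIntegrable (mittagLefflerKernel ρ μ (t * exp (I * θ))) (ρ * Real.log (t * R))
      (ρ * (θ + (-δ - π))) (ρ * (θ + (δ - π)))) :
    hankelIntegral (mittagLefflerKernel ρ μ (t * exp (I * θ))) (ρ * Real.log (t * R))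
        (ρ * (θ + (-δ - π))) (ρ * (θ + (δ - π))) / (2 * π * I) =
      (∫ r in Ioi R, mlK ρ μ r δ t θ) + ∫ φ in (-δ - π)..(δ - π), mlP ρ μ R φ t θ := by
  rw [integral_mlK hρ ht hR hk, integral_mlP hρ.ne' ht hR, hankelIntegral]
  ring

theorem abs_mul_lt_pi_div_two (hρ : 0 < ρ) (h : |θ - π| + |δ - π / ρ| < π / (2 * ρ)) :
    |ρ * (θ + (-δ - π)) + π| < π / 2 ∧ |ρ * (θ + (δ - π)) - π| < π / 2 := by
  have hscale : |ρ * (θ - π)| + |ρ * δ - π| < π / 2 := by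
    calc |ρ * (θ - π)| + |ρ * δ - π| = ρ * (|θ - π| + |δ - π / ρ|) := by
          rw [← abs_of_pos hρ, mul_add, ← abs_mul, ← abs_mul, abs_of_pos hρ, mul_sub ρ δ,
            mul_div_cancel₀ _ hρ.ne']
      _ < ρ * (π / (2 * ρ)) := by gcongr
      _ = π / 2 := by field
  constructor
  · rw [show ρ * (θ + (-δ - π)) + π = ρ * (θ - π) - (ρ * δ - π) by ring]
    exact (abs_sub _ _).trans_lt hscale
  · rw [show ρ * (θ + (δ - π)) - π = ρ * (θ - π) + (ρ * δ - π) by ring]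
    exact (abs_add_le _ _).trans_lt hscale

theorem integrable_and_mittagLeffler_eq_integral_mlK_add_integral_mlP (hρ : 0 < ρ) (ht : 0 < t)
    (hR : 1 < R) (μ : ℂ) (h : |θ - π| + |δ - π / ρ| < π / (2 * ρ)) :
    IntegrableOn (fun r ↦ mlK ρ μ r δ t θ) (Ioi R) ∧
      IntervalIntegrable (fun φ ↦ mlP ρ μ R φ t θ) volume (-δ - π) (δ - π) ∧
      mittagLeffler ρ μ (t * exp (I * θ)) =
        (∫ r in Ioi R, mlK ρ μ r δ t θ) + ∫ φ in (-δ - π)..(δ - π), mlP ρ μ R φ t θ := by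
  have hR₀ : 0 < R := one_pos.trans hR
  have hnorm := norm_mul_exp_mul_exp_neg_log_lt_one hρ.ne' ht hR θ
  obtain ⟨ha, hb⟩ := abs_mul_lt_pi_div_two hρ h
  have hk := hankelIntegrable_mittagLefflerKernel hρ.le μ hnorm (cos_neg_of_abs_add_pi_lt ha)
    (cos_neg_of_abs_sub_pi_lt hb)
  refine ⟨integrableOn_mlK hρ ht hR₀ hk, intervalIntegrable_mlP hρ.ne' ht hR₀ hk, ?_⟩
  rw [← hankelIntegral_mittagLefflerKernel_div hρ ht hR₀ hk]
  exact (hasSum_mittagLefflerTerm hρ.le μ hnorm ha hb).tsum_eq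

end PolarContour

section RealForm

variable {α : Type*} [MeasurableSpace α] {m : Measure α} {u v : α → ℝ}

theorem integrable_ofReal_add_I_mul_ofReal_iff :
    Integrable (fun x ↦ (u x + I * v x : ℂ)) m ↔ Integrable u m ∧ Integrable v m := by
  refine ⟨fun h ↦ ⟨?_, ?_⟩, fun h ↦ h.1.ofReal.add (h.2.ofReal.const_mul I)⟩
  · simpa using h.re
  · simpa using h.im

theorem integral_ofReal_add_I_mul_ofReal (hu : Integrable u m) (hv : Integrable v m) :
    ∫ x, (u x + I * v x : ℂ) ∂m = (∫ x, u x ∂m : ℝ) + I * (∫ x, v x ∂m : ℝ) := by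
  refine (integral_add hu.ofReal (hv.ofReal.const_mul I)).trans ?_
  rw [integral_const_mul]
  exact congr_arg₂ _ integral_ofReal (congr_arg _ integral_ofReal)

variable {ρ t R θ δ : ℝ}

theorem intervalIntegrable_ofReal_add_I_mul_ofReal_iff {u v : ℝ → ℝ} {ν : Measure ℝ} {a b : ℝ} :
    IntervalIntegrable (fun x ↦ (u x + I * v x : ℂ)) ν a b ↔
      IntervalIntegrable u ν a b ∧ IntervalIntegrable v ν a b := by
  simp only [intervalIntegrable_iff, IntegrableOn, integrable_ofReal_add_I_mul_ofReal_iff]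

theorem intervalIntegral_ofReal_add_I_mul_ofReal {u v : ℝ → ℝ} {ν : Measure ℝ} {a b : ℝ}
    (hu : IntervalIntegrable u ν a b) (hv : IntervalIntegrable v ν a b) :
    ∫ x in a..b, (u x + I * v x : ℂ) ∂ν =
      (∫ x in a..b, u x ∂ν : ℝ) + I * (∫ x in a..b, v x ∂ν : ℝ) := by
  simp only [intervalIntegral, integral_ofReal_add_I_mul_ofReal hu.1 hv.1,
    integral_ofReal_add_I_mul_ofReal hu.2 hv.2]
  push_cast
  ring

theorem integrable_and_mittagLeffler_eq_add_I_mul (hρ : 0 < ρ) (ht : 0 < t) (hR : 1 < R) (μ : ℂ)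
    (h : |θ - π| + |δ - π / ρ| < π / (2 * ρ)) :
    IntegrableOn (fun r ↦ mlKRe ρ μ r δ t θ) (Ioi R) ∧
      IntegrableOn (fun r ↦ mlKIm ρ μ r δ t θ) (Ioi R) ∧
      IntervalIntegrable (fun φ ↦ mlPRe ρ μ R φ t θ) volume (-δ - π) (δ - π) ∧
      IntervalIntegrable (fun φ ↦ mlPIm ρ μ R φ t θ) volume (-δ - π) (δ - π) ∧
      mittagLeffler ρ μ (t * exp (I * θ)) =
        ((∫ r in Ioi R, mlKRe ρ μ r δ t θ)
          + (∫ φ in (-δ - π)..(δ - π), mlPRe ρ μ R φ t θ) : ℝ)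
        + I * ((∫ r in Ioi R, mlKIm ρ μ r δ t θ)
          + (∫ φ in (-δ - π)..(δ - π), mlPIm ρ μ R φ t θ) : ℝ) := by
  obtain ⟨hK, hP, heq⟩ := integrable_and_mittagLeffler_eq_integral_mlK_add_integral_mlP hρ ht hR μ h
  obtain ⟨hKre, hKim⟩ := integrable_ofReal_add_I_mul_ofReal_iff.1 hK
  obtain ⟨hPre, hPim⟩ := intervalIntegrable_ofReal_add_I_mul_ofReal_iff.1 hP
  refine ⟨hKre, hKim, hPre, hPim, heq.trans ?_⟩
  simp only [mlK, mlP]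
  rw [integral_ofReal_add_I_mul_ofReal hKre hKim,
    intervalIntegral_ofReal_add_I_mul_ofReal hPre hPim]
  push_cast
  ring

end RealForm

section PiDiv

variable {ρ : ℝ}

theorem mul_add_pi_div_sub_pi (hρ : ρ ≠ 0) (θ : ℝ) :
    ρ * (θ + (π / ρ - π)) = ρ * (θ - π) + π := by
  field

theorem mul_add_neg_pi_div_sub_pi (hρ : ρ ≠ 0) (θ : ℝ) :
    ρ * (θ + (-(π / ρ) - π)) = ρ * (θ - π) - π := by
  field

theorem mlXi_pi_div_sub_pi (hρ : ρ ≠ 0) (μ : ℂ) (r t θ : ℝ) :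
    mlXi ρ μ r (π / ρ - π) t θ = mlXi' ρ μ r t θ + (1 - μ.re) * π := by
  rw [mlXi, mlXi', mul_right_comm ρ, mul_add_pi_div_sub_pi hρ, Real.sin_add_pi]
  ring

theorem mlXi_neg_pi_div_sub_pi (hρ : ρ ≠ 0) (μ : ℂ) (r t θ : ℝ) :
    mlXi ρ μ r (-(π / ρ) - π) t θ = mlXi' ρ μ r t θ - (1 - μ.re) * π := by
  rw [mlXi, mlXi', mul_right_comm ρ, mul_add_neg_pi_div_sub_pi hρ, Real.sin_sub_pi]
  ring

theorem mlF_pi_div_sub_pi (hρ : ρ ≠ 0) (μ : ℂ) (r t θ : ℝ) :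
    mlF ρ μ r (π / ρ - π) t θ = Real.exp (mlVarrho ρ μ r t θ) * Real.exp (μ.im * π) := by
  rw [mlF, mlVarrho, mul_right_comm ρ, mul_add_pi_div_sub_pi hρ, Real.cos_add_pi, ← Real.exp_add]
  ring_nf

theorem mlF_neg_pi_div_sub_pi (hρ : ρ ≠ 0) (μ : ℂ) (r t θ : ℝ) :
    mlF ρ μ r (-(π / ρ) - π) t θ = Real.exp (mlVarrho ρ μ r t θ) * Real.exp (-μ.im * π) := by
  rw [mlF, mlVarrho, mul_right_comm ρ, mul_add_neg_pi_div_sub_pi hρ, Real.cos_sub_pi,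
    ← Real.exp_add]
  ring_nf

theorem mlKRe_pi_div (hρ : ρ ≠ 0) (μ : ℂ) (r t θ : ℝ) :
    mlKRe ρ μ r (π / ρ) t θ = mlKRePi ρ μ r t θ := by
  rw [mlKRe, mlKRePi, mlXi_pi_div_sub_pi hρ, mlXi_neg_pi_div_sub_pi hρ, mlF_pi_div_sub_pi hρ,
    mlF_neg_pi_div_sub_pi hρ]
  ring

theorem mlKIm_pi_div (hρ : ρ ≠ 0) (μ : ℂ) (r t θ : ℝ) :
    mlKIm ρ μ r (π / ρ) t θ = mlKImPi ρ μ r t θ := by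
  rw [mlKIm, mlKImPi, mlXi_pi_div_sub_pi hρ, mlXi_neg_pi_div_sub_pi hρ, mlF_pi_div_sub_pi hρ,
    mlF_neg_pi_div_sub_pi hρ]
  ring

end PiDiv

theorem abs_sub_add_abs_sub_pi_div_lt {ρ δ θ x : ℝ} (hδ : δ ≤ π / ρ)
    (hl : π / (2 * ρ) - δ + x < θ) (hu : θ < -(π / (2 * ρ)) + δ + x) :
    |θ - x| + |δ - π / ρ| < π / (2 * ρ) := by
  have hhalf : π / ρ = 2 * (π / (2 * ρ)) := by ring
  have hθ : |θ - x| < δ - π / (2 * ρ) := abs_lt.2 ⟨by linarith, by linarith⟩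
  rw [abs_of_nonpos (a := δ - π / ρ) (by linarith)]
  linarith

theorem corollary1_general (ρ ε t θ : ℝ) (μ z : ℂ) (hρ : 0 < ρ) (hε : 0 < ε) (ht : 0 < t)
    (hz : z = t * exp (I * θ)) :
    Summable (mittagLefflerTerm ρ μ z) ∧
    (∀ δ : ℝ, |θ - π| + |δ - π / ρ| < π / (2 * ρ) →
      IntegrableOn (fun r ↦ mlKRe ρ μ r δ t θ) (Ioi (1 + ε)) ∧
      IntegrableOn (fun r ↦ mlKIm ρ μ r δ t θ) (Ioi (1 + ε)) ∧
      IntervalIntegrable (fun φ ↦ mlPRe ρ μ (1 + ε) φ t θ) volume (-δ - π) (δ - π) ∧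
      IntervalIntegrable (fun φ ↦ mlPIm ρ μ (1 + ε) φ t θ) volume (-δ - π) (δ - π) ∧
      mittagLeffler ρ μ z =
        (((∫ r in Ioi (1 + ε), mlKRe ρ μ r δ t θ)
          + (∫ φ in (-δ - π)..(δ - π), mlPRe ρ μ (1 + ε) φ t θ) : ℝ) : ℂ)
        + I *
          (((∫ r in Ioi (1 + ε), mlKIm ρ μ r δ t θ)
            + (∫ φ in (-δ - π)..(δ - π), mlPIm ρ μ (1 + ε) φ t θ) : ℝ) : ℂ)) ∧
    (|θ - π| < π / (2 * ρ) →
      IntegrableOn (fun r ↦ mlKRePi ρ μ r t θ) (Ioi (1 + ε)) ∧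
      IntegrableOn (fun r ↦ mlKImPi ρ μ r t θ) (Ioi (1 + ε)) ∧
      IntervalIntegrable (fun φ ↦ mlPRe ρ μ (1 + ε) φ t θ) volume (-(π / ρ) - π) (π / ρ - π) ∧
      IntervalIntegrable (fun φ ↦ mlPIm ρ μ (1 + ε) φ t θ) volume (-(π / ρ) - π) (π / ρ - π) ∧
      mittagLeffler ρ μ z =
        (((∫ r in Ioi (1 + ε), mlKRePi ρ μ r t θ)
          + (∫ φ in (-(π / ρ) - π)..(π / ρ - π), mlPRe ρ μ (1 + ε) φ t θ) : ℝ) : ℂ)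
        + I *
          (((∫ r in Ioi (1 + ε), mlKImPi ρ μ r t θ)
            + (∫ φ in (-(π / ρ) - π)..(π / ρ - π), mlPIm ρ μ (1 + ε) φ t θ) : ℝ) : ℂ)) := by
  subst hz
  have main (δ : ℝ) (h : |θ - π| + |δ - π / ρ| < π / (2 * ρ)) :=
    integrable_and_mittagLeffler_eq_add_I_mul hρ ht (R := 1 + ε) (by linarith) μ h
  refine ⟨summable_mittagLefflerTerm hρ μ _, main, fun h ↦ ?_⟩
  simpa only [mlKRe_pi_div hρ.ne', mlKIm_pi_div hρ.ne'] using main (π / ρ) (by simpa using h)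

end

theorem corollary1 (ρ ε t θ : ℝ) (μ z : ℂ) (hρ : 1 / 2 < ρ) (hε : 0 < ε) (ht : 0 < t)
    (hz : z = (t : ℂ) * Complex.exp (Complex.I * (θ : ℂ))) :
    -- the series defining the Mittag-Leffler function converges
    Summable (mittagLefflerTerm ρ μ z) ∧
    -- part 1
    (∀ δ : ℝ, Real.pi / (2 * ρ) < δ → δ ≤ min Real.pi (Real.pi / ρ) →
      Real.pi / (2 * ρ) - δ + Real.pi < θ → θ < -(Real.pi / (2 * ρ)) + δ + Real.pi →
      IntegrableOn (fun r => mlKRe ρ μ r δ t θ) (Ioi (1 + ε)) ∧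
      IntegrableOn (fun r => mlKIm ρ μ r δ t θ) (Ioi (1 + ε)) ∧
      IntervalIntegrable (fun φ => mlPRe ρ μ (1 + ε) φ t θ) volume
        (-δ - Real.pi) (δ - Real.pi) ∧
      IntervalIntegrable (fun φ => mlPIm ρ μ (1 + ε) φ t θ) volume
        (-δ - Real.pi) (δ - Real.pi) ∧
      mittagLeffler ρ μ z =
        (((∫ r in Ioi (1 + ε), mlKRe ρ μ r δ t θ)
          + (∫ φ in (-δ - Real.pi)..(δ - Real.pi), mlPRe ρ μ (1 + ε) φ t θ) : ℝ) : ℂ)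
        + Complex.I *
          (((∫ r in Ioi (1 + ε), mlKIm ρ μ r δ t θ)
            + (∫ φ in (-δ - Real.pi)..(δ - Real.pi), mlPIm ρ μ (1 + ε) φ t θ) : ℝ) : ℂ)) ∧
    -- part 2
    (1 ≤ ρ → ∀ δ : ℝ, δ = Real.pi / ρ →
      Real.pi / (2 * ρ) - δ + Real.pi < θ → θ < -(Real.pi / (2 * ρ)) + δ + Real.pi →
      IntegrableOn (fun r => mlKRePi ρ μ r t θ) (Ioi (1 + ε)) ∧
      IntegrableOn (fun r => mlKImPi ρ μ r t θ) (Ioi (1 + ε)) ∧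
      IntervalIntegrable (fun φ => mlPRe ρ μ (1 + ε) φ t θ) volume
        (-(Real.pi / ρ) - Real.pi) (Real.pi / ρ - Real.pi) ∧
      IntervalIntegrable (fun φ => mlPIm ρ μ (1 + ε) φ t θ) volume
        (-(Real.pi / ρ) - Real.pi) (Real.pi / ρ - Real.pi) ∧
      mittagLeffler ρ μ z =
        (((∫ r in Ioi (1 + ε), mlKRePi ρ μ r t θ)
          + (∫ φ in (-(Real.pi / ρ) - Real.pi)..(Real.pi / ρ - Real.pi),
              mlPRe ρ μ (1 + ε) φ t θ) : ℝ) : ℂ)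
        + Complex.I *
          (((∫ r in Ioi (1 + ε), mlKImPi ρ μ r t θ)
            + (∫ φ in (-(Real.pi / ρ) - Real.pi)..(Real.pi / ρ - Real.pi),
                mlPIm ρ μ (1 + ε) φ t θ) : ℝ) : ℂ)) := by
  obtain ⟨hsum, hsector, hpi⟩ := corollary1_general ρ ε t θ μ z (by linarith) hε ht hz
  exact ⟨hsum, fun δ _ hδ hl hu ↦ hsector δ
      (abs_sub_add_abs_sub_pi_div_lt (hδ.trans (min_le_right _ _)) hl hu),
    fun _ δ hδ hl hu ↦ hpi (by simpa [hδ] using abs_sub_add_abs_sub_pi_div_lt hδ.le hl hu)⟩
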